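/- Let $m, n_c, n_s \ge 1$ be integers. For each $j \in [n_c]$ let candidate sensor $j$ have output vector $\boldsymbol c_j \in \mathbb{R}^m$ and noise variance $\boldsymbol\sigma_j^2 > 0$, and put $\mathcal Z_j := \boldsymbol\sigma_j^{-2}\, \boldsymbol c_j \boldsymbol c_j^T$. Let $p$ be a probability vector on $[n_c]$, and let $\mathcal S = (\mathcal S_1,\dots,\mathcal S_{n_s})$ be drawn by sampling with replacement: the $\mathcal S_i$ are independent and $\mathbb P[\mathcal S_i = j] = p_j$ for all $i \in [n_s]$, $j \in [n_c]$. For a selection $\mathcal S$ let $C_{\mathcal S} \in \mathbb{R}^{n_s\times m}$ be the matrix with $i$-th row $\boldsymbol c_{\mathcal S_i}^T$ and let $R_{\mathcal S} := \mathrm{diag}(\boldsymbol\sigma_{\mathcal S_1}^2,\dots,\boldsymbol\sigma_{\mathcal S_{n_s}}^2)$. Put $\mathbb E[Z] := \sum_{j} p_j \mathcal Z_j$, the common expectation of the i.i.d. random matrices $Z_i := \mathcal Z_{\mathcal S_i}$. Write $A \preceq B$ if $B - A$ is positive semidefinite. Let $\rho \ge 1$, $\epsilon \in (0,1)$ and $\delta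 \in (0,1)$ satisfy $Z_i \preceq \rho\, \mathbb E[Z]$ almost surely for every $i \in [n_s]$, and $$\frac{\epsilon^2}{\rho} = \frac{4}{n_s} \log \frac{2m}{\delta}.$$ Let $\Sigma_{(t)} \in \mathbb{R}^{m \times m}$ be a fixed symmetric positive definite matrix (the predicted error covariance at time $t$), and set $$U_{S,(t)} := \bigl(\Sigma_{(t)}^{-1} + (1-\epsilon)\, n_s\, \mathbb E[Z]\bigr)^{-1}, \qquad L_{S,(t)} := \bigl(\Sigma_{(t)}^{-1} + (1+\epsilon)\, n_s\, \mathbb E[Z]\bigr)^{-1}.$$ For a selection $\mathcal S$ let $P_{\mathcal S,(t)} := \Sigma_{(t)} - \Sigma_{(t)} C_{\mathcal S}^T \bigl(R_{\mathcal S} + C_{\mathcal S} \Sigma_{(t)} C_{\mathcal S}^T\bigr)^{-1} C_{\mathcal S} \Sigma_{(t)}$ be the filtered error covariance at time $t$ of the Kalman filter that uses $\mathcal S$. Then $U_{S,(t)}$ and $L_{S,(t)}$ are positive definite; for every selection $\mathcal S \in [n_c]^{n_s}$ the matrix $P_{\mathcal S,(t)}$ is positive definite and $$P_{\mathcal S,(t)}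 = \bigl(\Sigma_{(t)}^{-1} + C_{\mathcal S}^T R_{\mathcal S}^{-1} C_{\mathcal S}\bigr)^{-1};$$ and for the random selection $\mathcal S$, $$\mathbb P\bigl[\, L_{S,(t)} \preceq P_{\mathcal S,(t)} \preceq U_{S,(t)} \,\bigr] \ge 1 - \delta.$$ -/

import Mathlib

open MeasureTheory ProbabilityTheory
-- `A ≤ B` for square matrices is the semi-definite (Loewner) order: `B - A` is positive semidefinite.
open scoped MatrixOrder

namespace SensorSelection

/-- The output matrix `C_S` of a selection `s`: its `i`-th row is the output vector of the
candidate sensor `s i`. -/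
def outputMatrix {m nc ns : ℕ} (c : Fin nc → Fin m → ℝ) (s : Fin ns → Fin nc) :
    Matrix (Fin ns) (Fin m) ℝ :=
  Matrix.of fun i => c (s i)

/-- The (diagonal) measurement noise covariance `R_S` of a selection `s`; `v j` is the noise
variance of candidate sensor `j`. -/
noncomputable def noiseCov {nc ns : ℕ} (v : Fin nc → ℝ) (s : Fin ns → Fin nc) :
    Matrix (Fin ns) (Fin ns) ℝ :=
  Matrix.diagonal fun i => v (s i)

/-- The matrix `σ_j⁻² c_j c_jᵀ` attached to candidate sensor `j`. -/
noncomputable def sensorMatrix {m nc : ℕ} (c : Fin nc → Fin m → ℝ) (v : Fin nc → ℝ)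
    (j : Fin nc) : Matrix (Fin m) (Fin m) ℝ :=
  (v j)⁻¹ • Matrix.vecMulVec (c j) (c j)

/-- `E[Z] = ∑ j, p j σ_j⁻² c_j c_jᵀ`, the expectation of the matrix of a sensor that is drawn
from the sampling distribution `p`. -/
noncomputable def meanMatrix {m nc : ℕ} (c : Fin nc → Fin m → ℝ) (v : Fin nc → ℝ)
    (p : Fin nc → ℝ) : Matrix (Fin m) (Fin m) ℝ :=
  ∑ j, p j • sensorMatrix c v j

/-- The measurement update of the Kalman filter: the filtered error covariance that results from
the predicted error covariance `P`, the output matrix `C` and the noise covariance `R`. -/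
noncomputable def filteredCov {m ns : ℕ} (P : Matrix (Fin m) (Fin m) ℝ)
    (C : Matrix (Fin ns) (Fin m) ℝ) (R : Matrix (Fin ns) (Fin ns) ℝ) :
    Matrix (Fin m) (Fin m) ℝ :=
  P - P * C.transpose * (R + C * P * C.transpose)⁻¹ * C * P

/-- `S` is a random selection drawn by sampling with replacement: its `ns` entries are
independent, and each of them is the candidate sensor `j` with probability `p j`. -/
structure IsSampleWithReplacement {Ω : Type*} [MeasurableSpace Ω] (μ : Measure Ω) {nc ns : ℕ}
    (p : Fin nc → ℝ) (S : Ω → Fin ns → Fin nc) : Prop where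
  measurable : ∀ i, Measurable fun ω => S ω i
  indep : iIndepFun (fun i ω => S ω i) μ
  law : ∀ i j, μ.real {ω | S ω i = j} = p j

/-- `meanMatrix` is the entrywise expectation of the matrix of each sampled sensor. -/
theorem IsSampleWithReplacement.integral_sensorMatrix {Ω : Type*} [MeasurableSpace Ω]
    {μ : Measure Ω} [IsProbabilityMeasure μ] {m nc ns : ℕ} {p : Fin nc → ℝ}
    {S : Ω → Fin ns → Fin nc} (hS : IsSampleWithReplacement μ p S)
    (c : Fin nc → Fin m → ℝ) (v : Fin nc → ℝ) (i : Fin ns) (a b : Fin m) :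
    ∫ ω, sensorMatrix c v (S ω i) a b ∂μ = meanMatrix c v p a b := by
  have h := integral_map (μ := μ) (hS.measurable i).aemeasurable
    (f := fun j => sensorMatrix c v j a b) (measurable_of_finite _).aestronglyMeasurable
  have : IsProbabilityMeasure (μ.map fun ω => S ω i) :=
    Measure.isProbabilityMeasure_map (hS.measurable i).aemeasurable
  rw [← h, integral_fintype .of_finite, meanMatrix, Matrix.sum_apply]
  refine Finset.sum_congr rfl fun j _ => ?_
  rw [map_measureReal_apply (hS.measurable i) (measurableSet_singleton j), Matrix.smul_apply,
    ← hS.law i j]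
  rfl

end SensorSelection

/-! In information form the filtered covariance is the inverse of Σ⁻¹ + ∑ Z_i, and inversion
reverses the Loewner order. So it suffices that (1-ε) n_s E[Z] ≼ ∑ Z_i ≼ (1+ε) n_s E[Z] fails with
probability at most 2m exp(-n_s ε²/(4ρ)), which the condition on ε makes equal to δ. This is the
matrix Chernoff bound `sum_prod_not_mem_Icc`.

Its proof is the Ahlswede–Winter argument: a congruence turns the mean into a multiple of the
identity, tr exp controls the largest eigenvalue, and Golden–Thompson (`trace_exp_add_le`) splits
off one sample at a time, each contributing a scalar factor. Golden–Thompson itself follows from tr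
(AB)^(2^k) ≤ tr A^(2^k) B^(2^k) and the Lie product formula. A singular mean is reached by adding
η·1 with η small. Probabilities are handled as finite sums of product weights over selections; the
measure enters only at the end. -/

namespace SensorSelection

open Matrix Filter Topology

/-! ### Trace inequalities for powers of matrix products -/

section TraceInequalities

variable {n : Type*} [Fintype n]

theorem trace_mul_pow_comm [DecidableEq n] (X Y : Matrix n n ℝ) (k : ℕ) :
    ((X * Y) ^ k).trace = ((Y * X) ^ k).trace := by
  cases k with
  | zero => simp
  | succ k =>
    have h : X * (Y * X) ^ k = (X * Y) ^ k * X :=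
      (show SemiconjBy X (Y * X) (X * Y) by simp [SemiconjBy, mul_assoc]).pow_right k
    rw [pow_succ, ← mul_assoc, ← h, trace_mul_comm, ← mul_assoc, ← pow_succ']

theorem two_mul_trace_conjTranspose_mul_le (X Y : Matrix n n ℝ) :
    2 * (Xᴴ * Y).trace ≤ (Xᴴ * X).trace + (Yᴴ * Y).trace := by
  have h := (posSemidef_conjTranspose_mul_self (X - Y)).trace_nonneg
  have h' : (Yᴴ * X).trace = (Xᴴ * Y).trace := by
    rw [← trace_transpose, ← conjTranspose_eq_transpose_of_trivial]
    simp
  simp only [conjTranspose_sub, sub_mul, mul_sub, trace_sub, h'] at h ⊢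
  linarith

variable [DecidableEq n]

/-- A power-trace inequality for an arbitrary matrix together with one for products of symmetric
matrices; each feeds the induction step of the other. -/
theorem trace_pow_two_pow_le_aux (k : ℕ) :
    (∀ X : Matrix n n ℝ, (X ^ 2 ^ (k + 1)).trace ≤ ((Xᴴ * X) ^ 2 ^ k).trace) ∧
    (∀ A B : Matrix n n ℝ, A.IsHermitian → B.IsHermitian →
      ((A * B) ^ 2 ^ k).trace ≤ (A ^ 2 ^ k * B ^ 2 ^ k).trace) := by
  induction k with
  | zero =>
    refine ⟨fun X => ?_, fun A B _ _ => by simp⟩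
    have h := two_mul_trace_conjTranspose_mul_le Xᴴ X
    simp only [conjTranspose_conjTranspose, trace_mul_comm X Xᴴ] at h
    simp only [zero_add, pow_one, pow_zero, sq]
    linarith
  | succ k ih =>
    obtain ⟨ih₁, ih₂⟩ := ih
    constructor
    · intro X
      have hA : (X * Xᴴ).IsHermitian := isHermitian_mul_conjTranspose_self X
      have hB : (Xᴴ * X).IsHermitian := isHermitian_conjTranspose_mul_self X
      calc (X ^ 2 ^ (k + 1 + 1)).trace = ((X * X) ^ 2 ^ (k + 1)).trace := by
            rw [← sq, ← pow_mul, pow_succ 2 (k + 1), mul_comm 2]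
        _ ≤ (((X * X)ᴴ * (X * X)) ^ 2 ^ k).trace := ih₁ _
        _ = (((Xᴴ * (Xᴴ * X)) * X) ^ 2 ^ k).trace := by simp [mul_assoc]
        _ = (((X * Xᴴ) * (Xᴴ * X)) ^ 2 ^ k).trace := by
            rw [trace_mul_pow_comm, ← mul_assoc X]
        _ ≤ ((X * Xᴴ) ^ 2 ^ k * (Xᴴ * X) ^ 2 ^ k).trace := ih₂ _ _ hA hB
        _ ≤ ((Xᴴ * X) ^ 2 ^ (k + 1)).trace := by
            -- Both squares on the right have the same trace, because X Xᴴ and Xᴴ X have equal power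
            -- traces.
            have h := two_mul_trace_conjTranspose_mul_le ((X * Xᴴ) ^ 2 ^ k) ((Xᴴ * X) ^ 2 ^ k)
            rw [(hA.pow _).eq, (hB.pow _).eq, ← pow_add, ← pow_add, ← two_mul, ← pow_succ',
              trace_mul_pow_comm X] at h
            linarith
    · intro A B hA hB
      calc ((A * B) ^ 2 ^ (k + 1)).trace ≤ (((A * B)ᴴ * (A * B)) ^ 2 ^ k).trace := ih₁ _
        _ = ((B * (A * A * B)) ^ 2 ^ k).trace := by
            rw [conjTranspose_mul, hA.eq, hB.eq]; simp only [mul_assoc]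
        _ = ((A ^ 2 * B ^ 2) ^ 2 ^ k).trace := by
            rw [trace_mul_pow_comm]; simp [sq, mul_assoc]
        _ ≤ ((A ^ 2) ^ 2 ^ k * (B ^ 2) ^ 2 ^ k).trace := ih₂ _ _ (hA.pow 2) (hB.pow 2)
        _ = _ := by rw [← pow_mul, ← pow_mul, ← pow_succ']

theorem trace_mul_pow_two_pow_le {A B : Matrix n n ℝ} (hA : A.IsHermitian) (hB : B.IsHermitian)
    (k : ℕ) : ((A * B) ^ 2 ^ k).trace ≤ (A ^ 2 ^ k * B ^ 2 ^ k).trace :=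
  (trace_pow_two_pow_le_aux k).2 A B hA hB

theorem trace_mul_nonneg {A B : Matrix n n ℝ} (hA : 0 ≤ A) (hB : 0 ≤ B) :
    0 ≤ (A * B).trace := by
  obtain ⟨Y, rfl⟩ := CStarAlgebra.nonneg_iff_eq_star_mul_self.mp hA
  rw [mul_assoc, trace_mul_comm]
  exact (hB.posSemidef.mul_mul_conjTranspose_same Y).trace_nonneg

theorem trace_mul_le_trace_mul {A B C : Matrix n n ℝ} (hA : 0 ≤ A) (hBC : B ≤ C) :
    (A * B).trace ≤ (A * C).trace := by
  have h := trace_mul_nonneg hA (sub_nonneg.mpr hBC)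
  rw [mul_sub, trace_sub] at h
  linarith

end TraceInequalities

/-! ### The Lie product formula -/

section LieProduct

/-- Telescoping. Taking b ≥ 1 allows the crude exponent k in place of k - 1. -/
theorem norm_pow_sub_pow_le {R : Type*} [NormedRing R] [NormOneClass R] {x y : R} {b : ℝ}
    (hb : 1 ≤ b) (hx : ‖x‖ ≤ b) (hy : ‖y‖ ≤ b) (k : ℕ) :
    ‖x ^ k - y ^ k‖ ≤ k * b ^ k * ‖x - y‖ := by
  induction k with
  | zero => simp
  | succ k ih =>
    have hb0 : 0 ≤ b := zero_le_one.trans hb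
    have h : x ^ (k + 1) - y ^ (k + 1) = x * (x ^ k - y ^ k) + (x - y) * y ^ k := by
      rw [pow_succ', pow_succ']; noncomm_ring
    have hyk : ‖y ^ k‖ ≤ b ^ (k + 1) :=
      (norm_pow_le y k).trans ((pow_le_pow_left₀ (norm_nonneg _) hy k).trans
        (pow_le_pow_right₀ hb k.le_succ))
    calc ‖x ^ (k + 1) - y ^ (k + 1)‖ ≤ ‖x‖ * ‖x ^ k - y ^ k‖ + ‖x - y‖ * ‖y ^ k‖ := by
          rw [h]; exact (norm_add_le _ _).trans (add_le_add (norm_mul_le _ _) (norm_mul_le _ _))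
      _ ≤ b * (k * b ^ k * ‖x - y‖) + ‖x - y‖ * b ^ (k + 1) := by gcongr
      _ = _ := by push_cast; ring

variable {R : Type*} [NormedRing R] [NormOneClass R] [NormedAlgebra ℝ R] [NormedAlgebra ℚ R]
  [CompleteSpace R]

omit [NormedAlgebra ℚ R] in
theorem norm_exp_le_exp_norm [Algebra ℚ R] (x : R) : ‖NormedSpace.exp x‖ ≤ Real.exp ‖x‖ := by
  rw [Real.exp_eq_exp_ℝ]
  refine HasSum.norm_le_of_bounded (NormedSpace.exp_series_hasSum_exp' (𝕂 := ℝ) x)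
    (NormedSpace.exp_series_hasSum_exp' (𝕂 := ℝ) ‖x‖) fun k => ?_
  rw [norm_smul, smul_eq_mul, Real.norm_of_nonneg (by positivity)]
  gcongr
  exact norm_pow_le x k

/-- The **Lie product formula**. -/
theorem tendsto_exp_mul_exp_pow (A B : R) :
    Tendsto (fun k : ℕ => (NormedSpace.exp ((k : ℝ)⁻¹ • A) *
      NormedSpace.exp ((k : ℝ)⁻¹ • B)) ^ k) atTop (𝓝 (NormedSpace.exp (A + B))) := by
  -- This difference vanishes to first order at 0, so at t = 1/k it is o(1/k). Passing to k-th
  -- powers costs only a factor k · exp(‖A‖ + ‖B‖).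
  have hd : HasDerivAt (fun t : ℝ => NormedSpace.exp (t • A) * NormedSpace.exp (t • B) -
      NormedSpace.exp (t • (A + B))) 0 0 := by
    have h := ((hasDerivAt_exp_smul_const (𝕂 := ℝ) A (0 : ℝ)).mul
      (hasDerivAt_exp_smul_const (𝕂 := ℝ) B (0 : ℝ))).sub
      (hasDerivAt_exp_smul_const (𝕂 := ℝ) (A + B) (0 : ℝ))
    refine h.congr_deriv ?_
    simp
  have hinv : Tendsto (fun k : ℕ => (k : ℝ)⁻¹) atTop (𝓝[≠] 0) := by
    refine tendsto_nhdsWithin_iff.mpr ⟨tendsto_inv_atTop_nhds_zero_nat, ?_⟩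
    filter_upwards [eventually_gt_atTop 0] with k hk
    simp [hk.ne']
  have hs := (hasDerivAt_iff_tendsto_slope_zero.mp hd).comp hinv
  rw [tendsto_iff_norm_sub_tendsto_zero]
  have hs' := (hs.norm).const_mul (Real.exp (‖A‖ + ‖B‖))
  simp only [norm_zero, mul_zero] at hs'
  refine squeeze_zero' (Eventually.of_forall fun _ => norm_nonneg _) ?_ hs'
  filter_upwards [eventually_gt_atTop 0] with k hk
  have hk' : (k : ℝ) ≠ 0 := by positivity
  have hE : NormedSpace.exp (A + B) = NormedSpace.exp ((k : ℝ)⁻¹ • (A + B)) ^ k := by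
    rw [← NormedSpace.exp_nsmul, ← Nat.cast_smul_eq_nsmul ℝ, smul_smul, mul_inv_cancel₀ hk',
      one_smul]
  set b := Real.exp ((k : ℝ)⁻¹ * (‖A‖ + ‖B‖)) with hb
  have hb1 : 1 ≤ b := Real.one_le_exp (by positivity)
  have hn : ∀ C : R, ‖NormedSpace.exp ((k : ℝ)⁻¹ • C)‖ ≤ Real.exp ((k : ℝ)⁻¹ * ‖C‖) := by
    intro C
    refine (norm_exp_le_exp_norm _).trans (le_of_eq ?_)
    simp [norm_smul]
  have hx : ‖NormedSpace.exp ((k : ℝ)⁻¹ • A) * NormedSpace.exp ((k : ℝ)⁻¹ • B)‖ ≤ b := by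
    rw [hb, mul_add, Real.exp_add]
    exact (norm_mul_le _ _).trans (mul_le_mul (hn A) (hn B) (norm_nonneg _) (Real.exp_pos _).le)
  have hy : ‖NormedSpace.exp ((k : ℝ)⁻¹ • (A + B))‖ ≤ b := by
    refine (hn _).trans (Real.exp_le_exp.mpr ?_)
    gcongr
    exact norm_add_le _ _
  have hbk : b ^ k = Real.exp (‖A‖ + ‖B‖) := by
    rw [hb, ← Real.exp_nat_mul, ← mul_assoc, mul_inv_cancel₀ hk', one_mul]
  rw [hE]
  refine (norm_pow_sub_pow_le hb1 hx hy k).trans (le_of_eq ?_)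
  rw [hbk]
  simp [norm_smul]
  ring

end LieProduct

/-! ### Golden–Thompson and spectral estimates for the exponential -/

section Exponential

variable {n : Type*} [Fintype n] [DecidableEq n]

/-- The **Golden–Thompson inequality**. -/
theorem trace_exp_add_le {A B : Matrix n n ℝ} (hA : A.IsHermitian) (hB : B.IsHermitian) :
    (NormedSpace.exp (A + B)).trace ≤ (NormedSpace.exp A * NormedSpace.exp B).trace := by
  -- The operator norm has ‖1‖ = 1 only for a nonempty index type.
  rcases isEmpty_or_nonempty n with h | h
  · simp [Matrix.trace]
  have hlim : Tendsto (fun k : ℕ => (NormedSpace.exp ((k : ℝ)⁻¹ • A) *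
      NormedSpace.exp ((k : ℝ)⁻¹ • B)) ^ k) atTop (𝓝 (NormedSpace.exp (A + B))) := by
    open scoped Matrix.Norms.Operator in exact tendsto_exp_mul_exp_pow A B
  -- The trace inequality covers exponents 2^k only, so the limit is taken along that subsequence.
  have hlim' := ((continuous_id.matrix_trace.tendsto _).comp hlim).comp
    (tendsto_pow_atTop_atTop_of_one_lt (one_lt_two : (1 : ℕ) < 2))
  refine le_of_tendsto hlim' (Eventually.of_forall fun k => ?_)
  have hpow : ∀ C : Matrix n n ℝ,
      NormedSpace.exp (((2 ^ k : ℕ) : ℝ)⁻¹ • C) ^ 2 ^ k = NormedSpace.exp C := by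
    intro C
    rw [← Matrix.exp_nsmul, ← Nat.cast_smul_eq_nsmul ℝ, smul_smul, mul_inv_cancel₀ (by positivity),
      one_smul]
  have hherm : ∀ {C : Matrix n n ℝ}, C.IsHermitian →
      (NormedSpace.exp (((2 ^ k : ℕ) : ℝ)⁻¹ • C)).IsHermitian := fun hC =>
    (hC.smul (IsSelfAdjoint.all _)).exp
  have h := trace_mul_pow_two_pow_le (hherm hA) (hherm hB) k
  rwa [hpow, hpow] at h

theorem exists_diagonalization {A : Matrix n n ℝ} (hA : A.IsHermitian) :
    ∃ (V : Matrix n n ℝ) (d : n → ℝ), V * Vᴴ = 1 ∧ Vᴴ * V = 1 ∧ A = V * diagonal d * Vᴴ := by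
  refine ⟨hA.eigenvectorUnitary, hA.eigenvalues, ?_, ?_, ?_⟩
  · exact Unitary.coe_mul_star_self hA.eigenvectorUnitary
  · exact Unitary.coe_star_mul_self hA.eigenvectorUnitary
  · conv_lhs => rw [hA.spectral_theorem]
    simp [Unitary.conjStarAlgAut_apply, star_eq_conjTranspose]

theorem exp_conj_diagonal {V : Matrix n n ℝ} (h₁ : V * Vᴴ = 1) (d : n → ℝ) :
    NormedSpace.exp (V * diagonal d * Vᴴ) = V * diagonal (fun i => Real.exp (d i)) * Vᴴ := by
  have hinv : V⁻¹ = Vᴴ := inv_eq_right_inv h₁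
  rw [← hinv, exp_conj _ _ (IsUnit.of_mul_eq_one _ h₁), exp_diagonal]
  congr 3
  ext i
  rw [Pi.coe_exp, Real.exp_eq_exp_ℝ]

theorem conj_diagonal_nonneg {V : Matrix n n ℝ} {d : n → ℝ} (hd : ∀ i, 0 ≤ d i) :
    0 ≤ V * diagonal d * Vᴴ :=
  ((PosSemidef.diagonal hd).mul_mul_conjTranspose_same V).nonneg

theorem conj_diagonal_nonneg_iff {V : Matrix n n ℝ} (h₂ : Vᴴ * V = 1) {d : n → ℝ} :
    0 ≤ V * diagonal d * Vᴴ ↔ ∀ i, 0 ≤ d i := by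
  refine ⟨fun h => ?_, conj_diagonal_nonneg⟩
  have h' := h.posSemidef.conjTranspose_mul_mul_same V
  have : Vᴴ * (V * diagonal d * Vᴴ) * V = diagonal d := by
    calc _ = (Vᴴ * V) * diagonal d * (Vᴴ * V) := by simp only [mul_assoc]
      _ = _ := by rw [h₂]; simp
  rw [this] at h'
  exact posSemidef_diagonal_iff.mp h'

theorem smul_one_eq_conj_diagonal {V : Matrix n n ℝ} (h₁ : V * Vᴴ = 1) (a : ℝ) :
    a • (1 : Matrix n n ℝ) = V * diagonal (fun _ => a) * Vᴴ := by
  have : (diagonal fun _ => a : Matrix n n ℝ) = a • 1 := by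
    rw [smul_one_eq_diagonal]
  rw [this, Matrix.mul_smul, mul_one, Matrix.smul_mul, h₁]

theorem conj_diagonal_sub (V : Matrix n n ℝ) (d e : n → ℝ) :
    V * diagonal d * Vᴴ - V * diagonal e * Vᴴ = V * diagonal (fun i => d i - e i) * Vᴴ := by
  rw [← diagonal_sub, mul_sub, sub_mul]

theorem conj_diagonal_add (V : Matrix n n ℝ) (d e : n → ℝ) :
    V * diagonal d * Vᴴ + V * diagonal e * Vᴴ = V * diagonal (fun i => d i + e i) * Vᴴ := by
  rw [← diagonal_add, mul_add, add_mul]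

theorem exp_nonneg_of_isHermitian {A : Matrix n n ℝ} (hA : A.IsHermitian) :
    0 ≤ NormedSpace.exp A := by
  obtain ⟨V, d, h₁, h₂, rfl⟩ := exists_diagonalization hA
  rw [exp_conj_diagonal h₁]
  exact conj_diagonal_nonneg fun i => (Real.exp_pos _).le

/-- On each eigenvalue x ∈ [0, 1], convexity puts exp(θx) below the chord joining the values at x =
0 and x = 1. -/
theorem exp_smul_le_of_mem_Icc {X : Matrix n n ℝ} (h0 : 0 ≤ X) (hle : X ≤ 1) (θ : ℝ) :
    NormedSpace.exp (θ • X) ≤ 1 + (Real.exp θ - 1) • X := by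
  obtain ⟨V, d, h₁, h₂, rfl⟩ := exists_diagonalization h0.posSemidef.isHermitian
  have hone : (1 : Matrix n n ℝ) = V * diagonal (fun _ => 1) * Vᴴ := by
    rw [← smul_one_eq_conj_diagonal h₁, one_smul]
  have hsmul : ∀ a : ℝ, a • (V * diagonal d * Vᴴ) = V * diagonal (fun i => a * d i) * Vᴴ := by
    intro a
    rw [← Matrix.smul_mul, ← Matrix.mul_smul, ← diagonal_smul]; rfl
  rw [conj_diagonal_nonneg_iff h₂] at h0
  rw [← sub_nonneg, hone, conj_diagonal_sub, conj_diagonal_nonneg_iff h₂] at hle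
  rw [← sub_nonneg, hsmul, hsmul, exp_conj_diagonal h₁, hone, conj_diagonal_add, conj_diagonal_sub,
    conj_diagonal_nonneg_iff h₂]
  intro i
  have h := convexOn_exp.2 (Set.mem_univ 0) (Set.mem_univ θ) (hle i) (h0 i) (by ring)
  simp only [smul_eq_mul, mul_zero, zero_add, Real.exp_zero, mul_one, mul_comm (d i)] at h
  linarith

/-- Some eigenvalue exceeds a, and the trace is a sum of positive terms exp(d i). -/
theorem exp_le_trace_exp {H : Matrix n n ℝ} (hH : H.IsHermitian) {a : ℝ}
    (h : ¬ H ≤ a • (1 : Matrix n n ℝ)) : Real.exp a ≤ (NormedSpace.exp H).trace := by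
  obtain ⟨V, d, h₁, h₂, rfl⟩ := exists_diagonalization hH
  rw [← sub_nonneg, smul_one_eq_conj_diagonal h₁, conj_diagonal_sub,
    conj_diagonal_nonneg_iff h₂] at h
  push Not at h
  obtain ⟨i, hi⟩ := h
  rw [exp_conj_diagonal h₁, mul_assoc, trace_mul_comm, mul_assoc, h₂, mul_one, trace_diagonal]
  calc Real.exp a ≤ Real.exp (d i) := Real.exp_le_exp.mpr (by linarith)
    _ ≤ _ := Finset.single_le_sum (f := fun i => Real.exp (d i)) (fun i _ => (Real.exp_pos _).le)
      (Finset.mem_univ i)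

end Exponential

/-! ### The matrix Chernoff bound -/

section MatrixChernoff

variable {n J : Type*} [Fintype n] [DecidableEq n] [Fintype J]

/-- Condition on the first sample, absorb it into A, apply induction to the others, then separate it
by Golden–Thompson. Since its averaged exponential is at most a scalar matrix, only tr exp A
remains. -/
theorem sum_prod_mul_trace_exp_le {w : J → ℝ} (hw : ∀ j, 0 ≤ w j) {X : J → Matrix n n ℝ}
    (hX : ∀ j, (X j).IsHermitian) {q : ℝ} (hq : 0 ≤ q)
    (h : ∑ j, w j • NormedSpace.exp (X j) ≤ q • (1 : Matrix n n ℝ)) (N : ℕ)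
    {A : Matrix n n ℝ} (hA : A.IsHermitian) :
    ∑ s : Fin N → J, (∏ i, w (s i)) * (NormedSpace.exp (A + ∑ i, X (s i))).trace ≤
      q ^ N * (NormedSpace.exp A).trace := by
  induction N generalizing A with
  | zero => simp
  | succ N ih =>
    rw [← (Fin.consEquiv fun _ => J).sum_comp, Fintype.sum_prod_type]
    calc _ = ∑ j, w j * ∑ s : Fin N → J, (∏ i, w (s i)) *
          (NormedSpace.exp ((A + X j) + ∑ i, X (s i))).trace := by
          refine Finset.sum_congr rfl fun j _ => ?_
          rw [Finset.mul_sum]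
          refine Finset.sum_congr rfl fun s _ => ?_
          simp [Fin.prod_univ_succ, Fin.sum_univ_succ, mul_assoc, add_assoc]
      _ ≤ ∑ j, w j * (q ^ N * (NormedSpace.exp A * NormedSpace.exp (X j)).trace) := by
          refine Finset.sum_le_sum fun j _ => mul_le_mul_of_nonneg_left ?_ (hw j)
          exact (ih (hA.add (hX j))).trans
            (mul_le_mul_of_nonneg_left (trace_exp_add_le hA (hX j)) (pow_nonneg hq N))
      _ = q ^ N * (NormedSpace.exp A * ∑ j, w j • NormedSpace.exp (X j)).trace := by
          rw [Finset.mul_sum, trace_sum, Finset.mul_sum]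
          refine Finset.sum_congr rfl fun j _ => ?_
          rw [Matrix.mul_smul, trace_smul, smul_eq_mul]; ring
      _ ≤ q ^ N * (NormedSpace.exp A * q • (1 : Matrix n n ℝ)).trace :=
          mul_le_mul_of_nonneg_left
            (trace_mul_le_trace_mul (exp_nonneg_of_isHermitian hA) h) (pow_nonneg hq N)
      _ = q ^ (N + 1) * (NormedSpace.exp A).trace := by
          rw [Matrix.mul_smul, mul_one, trace_smul, smul_eq_mul]; ring

open Classical in
-- Markov's inequality applied to tr exp of the sum.
theorem sum_prod_not_le_smul_one {w : J → ℝ} (hw : ∀ j, 0 ≤ w j) {X : J → Matrix n n ℝ}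
    (hX : ∀ j, (X j).IsHermitian) {q : ℝ} (hq : 0 ≤ q)
    (h : ∑ j, w j • NormedSpace.exp (X j) ≤ q • (1 : Matrix n n ℝ)) (N : ℕ) (a : ℝ) :
    ∑ s : Fin N → J with ¬ ∑ i, X (s i) ≤ a • (1 : Matrix n n ℝ), ∏ i, w (s i) ≤
      Real.exp (-a) * (q ^ N * Fintype.card n) := by
  have hpos : ∀ s : Fin N → J, 0 ≤ ∏ i, w (s i) := fun s => Finset.prod_nonneg fun i _ => hw _
  have hherm : ∀ s : Fin N → J, (∑ i, X (s i)).IsHermitian := fun s =>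
    isSelfAdjoint_sum _ fun i _ => hX _
  have key := sum_prod_mul_trace_exp_le hw hX hq h N (isHermitian_zero (n := n))
  simp only [zero_add, NormedSpace.exp_zero, trace_one] at key
  refine le_trans ?_ (mul_le_mul_of_nonneg_left key (Real.exp_pos _).le)
  rw [Finset.mul_sum]
  refine (Finset.sum_le_sum fun s hs => ?_).trans
    (Finset.sum_le_univ_sum_of_nonneg (s := Finset.univ.filter fun s : Fin N → J =>
      ¬ ∑ i, X (s i) ≤ a • (1 : Matrix n n ℝ)) fun s => ?_)
  · have hle := exp_le_trace_exp (hherm s) (Finset.mem_filter.mp hs).2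
    calc ∏ i, w (s i) = Real.exp (-a) * ((∏ i, w (s i)) * Real.exp a) := by
          rw [mul_left_comm, ← Real.exp_add]; simp
      _ ≤ _ := mul_le_mul_of_nonneg_left (mul_le_mul_of_nonneg_left hle (hpos s))
        (Real.exp_pos _).le
  · exact mul_nonneg (Real.exp_pos _).le (mul_nonneg (hpos s)
      (exp_nonneg_of_isHermitian (hherm s)).posSemidef.trace_nonneg)

open Classical in
-- The chord bound makes the averaged exponential at most 1 + r(e^θ - 1), hence at most exp(r(θ +
-- θ²)) when |θ| ≤ 1. The sign of θ selects the tail.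
theorem sum_prod_not_smul_le_smul_one {w : J → ℝ} (hw : w ∈ stdSimplex ℝ J)
    {X : J → Matrix n n ℝ} (hX : ∀ j, 0 ≤ X j) (hX1 : ∀ j, w j ≠ 0 → X j ≤ 1) {r : ℝ}
    (hr : 0 ≤ r) (hsum : ∑ j, w j • X j = r • (1 : Matrix n n ℝ)) {θ : ℝ} (hθ : |θ| ≤ 1)
    (N : ℕ) (a : ℝ) :
    ∑ s : Fin N → J with ¬ θ • ∑ i, X (s i) ≤ a • (1 : Matrix n n ℝ), ∏ i, w (s i) ≤
      Fintype.card n * Real.exp (N * (r * (θ + θ ^ 2)) - a) := by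
  have hθ' : Real.exp θ - 1 ≤ θ + θ ^ 2 := by
    have := (abs_le.mp (Real.abs_exp_sub_one_sub_id_le hθ)).2
    linarith
  have hle : ∑ j, w j • NormedSpace.exp (θ • X j) ≤
      Real.exp (r * (θ + θ ^ 2)) • (1 : Matrix n n ℝ) := by
    calc ∑ j, w j • NormedSpace.exp (θ • X j)
        ≤ ∑ j, w j • (1 + (Real.exp θ - 1) • X j) := by
          refine Finset.sum_le_sum fun j _ => ?_
          by_cases hj : w j = 0
          · simp [hj]
          · exact smul_le_smul_of_nonneg_left (exp_smul_le_of_mem_Icc (hX j) (hX1 j hj) θ) (hw.1 j)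
      _ = (1 + r * (Real.exp θ - 1)) • (1 : Matrix n n ℝ) := by
          simp_rw [smul_add, Finset.sum_add_distrib, ← Finset.sum_smul, hw.2,
            smul_comm (w _) (Real.exp θ - 1), ← Finset.smul_sum, hsum]
          module
      _ ≤ _ := by
          refine smul_le_smul_of_nonneg_right ?_ zero_le_one
          have := Real.add_one_le_exp (r * (θ + θ ^ 2))
          have := mul_le_mul_of_nonneg_left hθ' hr
          linarith
  have h := sum_prod_not_le_smul_one hw.1
    (fun j => (hX j).posSemidef.isHermitian.smul (IsSelfAdjoint.all θ)) (Real.exp_pos _).le hle N a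
  simp only [← Finset.smul_sum] at h
  refine h.trans (le_of_eq ?_)
  rw [← Real.exp_nat_mul, ← mul_assoc, ← Real.exp_add, mul_comm]
  congr 2
  ring

open Classical in
/-- A two-sided **matrix Chernoff bound** for sampling with replacement, normalized mean. -/
theorem sum_prod_not_mem_Icc_smul_one {w : J → ℝ} (hw : w ∈ stdSimplex ℝ J)
    {X : J → Matrix n n ℝ} (hX : ∀ j, 0 ≤ X j) (hX1 : ∀ j, w j ≠ 0 → X j ≤ 1) {r : ℝ}
    (hr : 0 ≤ r) (hsum : ∑ j, w j • X j = r • (1 : Matrix n n ℝ)) {ε : ℝ}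
    (hε : ε ∈ Set.Ioo (0 : ℝ) 1) (N : ℕ) :
    ∑ s : Fin N → J with ¬ (((1 - ε) * N * r) • (1 : Matrix n n ℝ) ≤ ∑ i, X (s i) ∧
        ∑ i, X (s i) ≤ ((1 + ε) * N * r) • (1 : Matrix n n ℝ)), ∏ i, w (s i) ≤
      2 * Fintype.card n * Real.exp (-(N * r * ε ^ 2 / 4)) := by
  -- With t = |θ| both exponents are Nr(t² - εt), minimized at t = ε/2 with value -Nrε²/4.
  have hup := sum_prod_not_smul_le_smul_one hw hX hX1 hr hsum (θ := ε / 2)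
    (by rw [abs_le]; constructor <;> linarith [hε.1, hε.2]) N (ε / 2 * ((1 + ε) * N * r))
  have hlow := sum_prod_not_smul_le_smul_one hw hX hX1 hr hsum (θ := -(ε / 2))
    (by rw [abs_le]; constructor <;> linarith [hε.1, hε.2]) N (-(ε / 2) * ((1 - ε) * N * r))
  have e1 : N * (r * (ε / 2 + (ε / 2) ^ 2)) - ε / 2 * ((1 + ε) * N * r) =
      -(N * r * ε ^ 2 / 4) := by ring
  have e2 : N * (r * (-(ε / 2) + (-(ε / 2)) ^ 2)) - -(ε / 2) * ((1 - ε) * N * r) =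
      -(N * r * ε ^ 2 / 4) := by ring
  rw [e1] at hup
  rw [e2] at hlow
  have hε2 : 0 < ε / 2 := half_pos hε.1
  simp only [← smul_smul (ε / 2), smul_le_smul_iff_of_pos_left hε2] at hup
  simp only [← smul_smul (-(ε / 2)), neg_smul, neg_le_neg_iff,
    smul_le_smul_iff_of_pos_left hε2] at hlow
  have hpos : ∀ s : Fin N → J, 0 ≤ ∏ i, w (s i) := fun s => Finset.prod_nonneg fun i _ => hw.1 _
  simp only [not_and_or, Finset.filter_or]
  have hunion := Finset.sum_union_inter
    (s₁ := Finset.univ.filter fun s : Fin N → J =>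
      ¬ ((1 - ε) * N * r) • (1 : Matrix n n ℝ) ≤ ∑ i, X (s i))
    (s₂ := Finset.univ.filter fun s : Fin N → J =>
      ¬ ∑ i, X (s i) ≤ ((1 + ε) * N * r) • (1 : Matrix n n ℝ))
    (f := fun s : Fin N → J => ∏ i, w (s i))
  have := Finset.sum_nonneg (fun s (_ : s ∈ (Finset.univ.filter fun s : Fin N → J =>
      ¬ ((1 - ε) * N * r) • (1 : Matrix n n ℝ) ≤ ∑ i, X (s i)) ∩
      Finset.univ.filter fun s : Fin N → J =>
      ¬ ∑ i, X (s i) ≤ ((1 + ε) * N * r) • (1 : Matrix n n ℝ)) => hpos s)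
  linarith

theorem exists_congr_eq_one {M : Matrix n n ℝ} (hM : M.PosDef) :
    ∃ T : Matrix n n ℝ, IsUnit T ∧ star T * M * T = 1 := by
  obtain ⟨B, hB⟩ := CStarAlgebra.nonneg_iff_eq_star_mul_self.mp hM.posSemidef.nonneg
  have hBu : IsUnit B.det := by
    have := (isUnit_iff_isUnit_det _).mp hM.isUnit
    rw [hB, det_mul] at this
    exact isUnit_of_mul_isUnit_right this
  refine ⟨B⁻¹, (isUnit_iff_isUnit_det _).mpr (isUnit_nonsing_inv_det B hBu), ?_⟩
  rw [hB, ← mul_assoc, ← star_mul, mul_assoc, mul_nonsing_inv B hBu]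
  simp

theorem star_conj_le_star_conj_iff {T : Matrix n n ℝ} (hT : IsUnit T) {A B : Matrix n n ℝ} :
    star T * A * T ≤ star T * B * T ↔ A ≤ B := by
  rw [le_iff, le_iff, ← sub_mul, ← mul_sub, hT.posSemidef_star_left_conjugate_iff]

open Classical in
-- Whitening: with T* M T = 1, the matrices ρ⁻¹ T* Z_j T of nonzero weight are at most 1 and the
-- mean is ρ⁻¹ · 1, so the normalized bound applies with r = ρ⁻¹.
theorem sum_prod_not_mem_Icc_of_posDef {w : J → ℝ} (hw : w ∈ stdSimplex ℝ J)
    {Z : J → Matrix n n ℝ} (hZ : ∀ j, 0 ≤ Z j) {M : Matrix n n ℝ} (hM : M.PosDef)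
    (hsum : ∑ j, w j • Z j = M) {ρ : ℝ} (hρ : 0 < ρ) (hle : ∀ j, w j ≠ 0 → Z j ≤ ρ • M)
    {ε : ℝ} (hε : ε ∈ Set.Ioo (0 : ℝ) 1) (N : ℕ) :
    ∑ s : Fin N → J with ¬ (((1 - ε) * N) • M ≤ ∑ i, Z (s i) ∧
        ∑ i, Z (s i) ≤ ((1 + ε) * N) • M), ∏ i, w (s i) ≤
      2 * Fintype.card n * Real.exp (-(N * ρ⁻¹ * ε ^ 2 / 4)) := by
  obtain ⟨T, hT, hTM⟩ := exists_congr_eq_one hM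
  have hρ' : 0 < ρ⁻¹ := inv_pos.mpr hρ
  have h := sum_prod_not_mem_Icc_smul_one hw (X := fun j => ρ⁻¹ • (star T * Z j * T))
    (fun j => smul_nonneg hρ'.le (star_left_conjugate_nonneg (hZ j) T))
    (fun j hj => by
      have := smul_le_smul_of_nonneg_left
        ((star_conj_le_star_conj_iff hT).mpr (hle j hj)) hρ'.le
      rwa [Matrix.mul_smul, Matrix.smul_mul, hTM, smul_smul, inv_mul_cancel₀ hρ.ne',
        one_smul] at this)
    hρ'.le
    (by
      rw [← hTM, ← hsum, Finset.mul_sum, Finset.sum_mul, Finset.smul_sum]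
      refine Finset.sum_congr rfl fun j _ => ?_
      rw [Matrix.mul_smul, Matrix.smul_mul, smul_comm])
    hε N
  have hconj : ∀ t : ℝ, (t * ρ⁻¹) • (1 : Matrix n n ℝ) = ρ⁻¹ • (star T * (t • M) * T) := by
    intro t
    rw [Matrix.mul_smul, Matrix.smul_mul, hTM, smul_smul, mul_comm]
  simpa only [hconj, ← Finset.smul_sum, ← Finset.mul_sum, ← Finset.sum_mul,
    smul_le_smul_iff_of_pos_left hρ', star_conj_le_star_conj_iff hT] using h

omit [Fintype J] in
theorem nonneg_of_frequently_add_smul_one_nonneg {A : Matrix n n ℝ} (hA : A.IsHermitian) {c : ℝ}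
    (h : ∃ᶠ η : ℝ in 𝓝[>] 0, 0 ≤ A + (η * c) • (1 : Matrix n n ℝ)) : 0 ≤ A := by
  refine (PosSemidef.of_dotProduct_mulVec_nonneg hA fun x => ?_).nonneg
  have hlim : Tendsto (fun η : ℝ => star x ⬝ᵥ A *ᵥ x + η * c * (star x ⬝ᵥ x)) (𝓝[>] 0)
      (𝓝 (star x ⬝ᵥ A *ᵥ x)) := by
    have : Continuous fun η : ℝ => star x ⬝ᵥ A *ᵥ x + η * c * (star x ⬝ᵥ x) := by fun_prop
    simpa using (this.tendsto 0).mono_left nhdsWithin_le_nhds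
  refine ge_of_tendsto_of_frequently hlim (h.mono fun η hη => ?_)
  have := hη.posSemidef.dotProduct_mulVec_nonneg x
  rwa [add_mulVec, smul_mulVec, one_mulVec, dotProduct_add, dotProduct_smul, smul_eq_mul] at this

open Classical in
/-- A two-sided **matrix Chernoff bound** for sampling with replacement. The mean may be
singular. -/
theorem sum_prod_not_mem_Icc {w : J → ℝ} (hw : w ∈ stdSimplex ℝ J)
    {Z : J → Matrix n n ℝ} (hZ : ∀ j, 0 ≤ Z j) {M : Matrix n n ℝ}
    (hsum : ∑ j, w j • Z j = M) {ρ : ℝ} (hρ : 1 ≤ ρ) (hle : ∀ j, w j ≠ 0 → Z j ≤ ρ • M)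
    {ε : ℝ} (hε : ε ∈ Set.Ioo (0 : ℝ) 1) (N : ℕ) :
    ∑ s : Fin N → J with ¬ (((1 - ε) * N) • M ≤ ∑ i, Z (s i) ∧
        ∑ i, Z (s i) ≤ ((1 + ε) * N) • M), ∏ i, w (s i) ≤
      2 * Fintype.card n * Real.exp (-(N * ρ⁻¹ * ε ^ 2 / 4)) := by
  have hM : 0 ≤ M := hsum ▸ Finset.sum_nonneg fun j _ => smul_nonneg (hw.1 j) (hZ j)
  have hherm : ∀ s : Fin N → J, (∑ i, Z (s i)).IsHermitian := fun s =>
    isSelfAdjoint_sum _ fun i _ => (hZ _).posSemidef.isHermitian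
  have hMh : ∀ t : ℝ, (t • M).IsHermitian := fun t =>
    hM.posSemidef.isHermitian.smul (IsSelfAdjoint.all t)
  -- Adding η·1 to every Z_j makes the mean positive definite; ρ ≥ 1 keeps Z_j + η·1 ≼ ρ(M + η·1).
  have hpert : ∀ η : ℝ, 0 < η → ∑ s : Fin N → J with
      ¬ (((1 - ε) * N) • (M + η • 1) ≤ ∑ i, (Z (s i) + η • 1) ∧
        ∑ i, (Z (s i) + η • 1) ≤ ((1 + ε) * N) • (M + η • 1)), ∏ i, w (s i) ≤
      2 * Fintype.card n * Real.exp (-(N * ρ⁻¹ * ε ^ 2 / 4)) := by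
    intro η hη
    have hη1 : 0 ≤ η • (1 : Matrix n n ℝ) := smul_nonneg hη.le zero_le_one
    refine sum_prod_not_mem_Icc_of_posDef hw (fun j => add_nonneg (hZ j) hη1)
      (PosDef.posSemidef_add hM.posSemidef ?_) ?_ (zero_lt_one.trans_le hρ) (fun j hj => ?_) hε N
    · exact PosDef.one.smul hη
    · simp only [smul_add, Finset.sum_add_distrib, hsum, ← Finset.sum_smul, hw.2, one_smul]
    · rw [smul_add]
      exact add_le_add (hle j hj) (le_smul_of_one_le_left hη1 hρ)
  -- There are finitely many selections, so a single small η makes the perturbed good event imply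
  -- the original one.
  have hev : ∀ᶠ η : ℝ in 𝓝[>] 0, ∀ s : Fin N → J,
      (((1 - ε) * N) • (M + η • 1) ≤ ∑ i, (Z (s i) + η • 1) ∧
        ∑ i, (Z (s i) + η • 1) ≤ ((1 + ε) * N) • (M + η • 1)) →
      (((1 - ε) * N) • M ≤ ∑ i, Z (s i) ∧ ∑ i, Z (s i) ≤ ((1 + ε) * N) • M) := by
    refine eventually_all.mpr fun s => ?_
    by_contra hcon
    rw [not_eventually] at hcon
    simp only [Classical.not_imp] at hcon
    obtain ⟨-, -, hbad⟩ := hcon.exists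
    refine hbad ⟨?_, ?_⟩
    · rw [← sub_nonneg]
      -- The perturbation contributes Nη - (1-ε)Nη = εNη; the upper side gives the same amount.
      refine nonneg_of_frequently_add_smul_one_nonneg ((hherm s).sub (hMh _)) (c := ε * N)
        (hcon.mono fun η hη => ?_)
      convert sub_nonneg.mpr hη.1.1 using 1
      simp only [Finset.sum_add_distrib, Finset.sum_const, Finset.card_univ, Fintype.card_fin,
        ← Nat.cast_smul_eq_nsmul ℝ]
      module
    · rw [← sub_nonneg]
      refine nonneg_of_frequently_add_smul_one_nonneg ((hMh _).sub (hherm s)) (c := ε * N)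
        (hcon.mono fun η hη => ?_)
      convert sub_nonneg.mpr hη.1.2 using 1
      simp only [Finset.sum_add_distrib, Finset.sum_const, Finset.card_univ, Fintype.card_fin,
        ← Nat.cast_smul_eq_nsmul ℝ]
      module
  obtain ⟨η, hη, hpos⟩ := (hev.and self_mem_nhdsWithin).exists
  refine (Finset.sum_le_sum_of_subset_of_nonneg ?_ fun s _ _ =>
    Finset.prod_nonneg fun i _ => hw.1 _).trans (hpert η hpos)
  exact Finset.monotone_filter_right _ fun s _ hs hs' => hs (hη s hs')

end MatrixChernoff

/-! ### Inverse monotonicity and the information form -/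

section KalmanFilter

/-- The block matrix [[B, 1], [1, A⁻¹]] has Schur complements A⁻¹ - B⁻¹ and B - A, so both are
positive semidefinite or neither is. -/
theorem inv_le_inv_of_le {n : Type*} [Fintype n] [DecidableEq n] {A B : Matrix n n ℝ}
    (hA : A.PosDef) (hAB : A ≤ B) : B⁻¹ ≤ A⁻¹ := by
  have hB : B.PosDef := by
    rw [← add_sub_cancel A B]
    exact hA.add_posSemidef hAB
  have := hB.isUnit.invertible
  have := hA.inv.isUnit.invertible
  rw [le_iff]
  have h := hB.fromBlocks₁₁ (1 : Matrix n n ℝ) A⁻¹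
  have h' := hA.inv.fromBlocks₂₂ B (1 : Matrix n n ℝ)
  rw [nonsing_inv_nonsing_inv _ ((isUnit_iff_isUnit_det _).mp hA.isUnit)] at h'
  simp only [conjTranspose_one, one_mul, mul_one] at h h'
  exact h.mp (h'.mpr hAB)

variable {m nc ns : ℕ}

theorem sensorMatrix_nonneg (c : Fin nc → Fin m → ℝ) {v : Fin nc → ℝ} (hv : ∀ j, 0 < v j)
    (j : Fin nc) : 0 ≤ sensorMatrix c v j :=
  smul_nonneg (inv_pos.mpr (hv j)).le (posSemidef_vecMulVec_self_star (c j)).nonneg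

theorem outputMatrix_transpose_mul_noiseCov_inv_mul (c : Fin nc → Fin m → ℝ) {v : Fin nc → ℝ}
    (hv : ∀ j, 0 < v j) (s : Fin ns → Fin nc) :
    (outputMatrix c s).transpose * (noiseCov v s)⁻¹ * outputMatrix c s =
      ∑ i, sensorMatrix c v (s i) := by
  have hinv : (noiseCov v s)⁻¹ = diagonal fun i => (v (s i))⁻¹ := by
    refine inv_eq_right_inv ?_
    rw [noiseCov, diagonal_mul_diagonal, ← diagonal_one]
    congr 1
    ext i
    exact mul_inv_cancel₀ (hv _).ne'
  ext a b
  rw [hinv, mul_apply, Matrix.sum_apply]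
  refine Finset.sum_congr rfl fun i _ => ?_
  simp only [mul_diagonal, transpose_apply, outputMatrix, of_apply, sensorMatrix,
    Matrix.smul_apply, vecMulVec_apply, smul_eq_mul]
  ring

/-- The **information form** of the measurement update of the Kalman filter. -/
theorem filteredCov_eq_inv {P : Matrix (Fin m) (Fin m) ℝ} (hP : P.PosDef)
    (C : Matrix (Fin ns) (Fin m) ℝ) {R : Matrix (Fin ns) (Fin ns) ℝ} (hR : R.PosDef) :
    filteredCov P C R = (P⁻¹ + C.transpose * R⁻¹ * C)⁻¹ := by
  have hPu := (isUnit_iff_isUnit_det _).mp hP.isUnit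
  have hRu := (isUnit_iff_isUnit_det _).mp hR.isUnit
  have hsum : (R + C * P * C.transpose).PosDef :=
    hR.add_posSemidef (hP.posSemidef.mul_mul_conjTranspose_same C)
  rw [add_mul_mul_inv_eq_sub _ _ _ _ hP.inv.isUnit hR.inv.isUnit
    (by simpa only [nonsing_inv_nonsing_inv _ hPu, nonsing_inv_nonsing_inv _ hRu]
      using hsum.isUnit),
    nonsing_inv_nonsing_inv _ hPu, nonsing_inv_nonsing_inv _ hRu, filteredCov]

end KalmanFilter

/-! ### The law of the random selection -/

section Sampling

variable {Ω : Type*} [MeasurableSpace Ω] {μ : Measure Ω} {nc ns : ℕ} {p : Fin nc → ℝ}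
  {S : Ω → Fin ns → Fin nc}

theorem IsSampleWithReplacement.measureReal_eq_prod (hS : IsSampleWithReplacement μ p S)
    (s : Fin ns → Fin nc) : μ.real (S ⁻¹' {s}) = ∏ i, p (s i) := by
  have h := hS.indep.measure_inter_preimage_eq_mul Finset.univ
    (sets := fun i => {s i}) fun i _ => measurableSet_singleton _
  have hset : S ⁻¹' {s} = ⋂ i ∈ Finset.univ, (fun ω => S ω i) ⁻¹' {s i} := by
    ext ω
    simp [funext_iff]
  rw [hset, measureReal_def, h, ENNReal.toReal_prod]
  exact Finset.prod_congr rfl fun i _ => hS.law i (s i)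

theorem IsSampleWithReplacement.measureReal_mem [IsFiniteMeasure μ]
    (hS : IsSampleWithReplacement μ p S) (F : Finset (Fin ns → Fin nc)) :
    μ.real (S ⁻¹' F) = ∑ s ∈ F, ∏ i, p (s i) := by
  have hm : Measurable S := measurable_pi_lambda _ hS.measurable
  rw [← sum_measureReal_preimage_singleton F fun s _ => hm (measurableSet_singleton s)]
  exact Finset.sum_congr rfl fun s _ => hS.measureReal_eq_prod s

end Sampling

end SensorSelection

/-! ### The main theorem -/

open SensorSelection Matrix in
theorem theorem2 {Ω : Type*} [MeasurableSpace Ω] (μ : Measure Ω) [IsProbabilityMeasure μ]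
    (m nc ns : ℕ) (hm : 0 < m) (hns : 0 < ns)
    -- the candidate sensors: output vectors and positive noise variances
    (c : Fin nc → Fin m → ℝ) (v : Fin nc → ℝ) (hv : ∀ j, 0 < v j)
    -- the sampling distribution and the random selection
    (p : Fin nc → ℝ) (hp : p ∈ stdSimplex ℝ (Fin nc))
    (S : Ω → Fin ns → Fin nc) (hS : SensorSelection.IsSampleWithReplacement μ p S)
    -- the conditions on the parameters
    (ρ ε δ : ℝ) (hρ : 1 ≤ ρ) (hε : ε ∈ Set.Ioo (0 : ℝ) 1) (hδ : δ ∈ Set.Ioo (0 : ℝ) 1)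
    (hZ : ∀ i, ∀ᵐ ω ∂μ,
      SensorSelection.sensorMatrix c v (S ω i) ≤ ρ • SensorSelection.meanMatrix c v p)
    (hc₀ : ε ^ 2 / ρ = 4 / (ns : ℝ) * Real.log (2 * (m : ℝ) / δ))
    -- the predicted error covariance
    (Sig : Matrix (Fin m) (Fin m) ℝ) (hSig : Sig.PosDef)
    -- the bounds, and the filtered error covariance of a selection
    (U L : Matrix (Fin m) (Fin m) ℝ)
    (hU : U = (Sig⁻¹ + ((1 - ε) * (ns : ℝ)) • SensorSelection.meanMatrix c v p)⁻¹)
    (hL : L = (Sig⁻¹ + ((1 + ε) * (ns : ℝ)) • SensorSelection.meanMatrix c v p)⁻¹)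
    (P : (Fin ns → Fin nc) → Matrix (Fin m) (Fin m) ℝ)
    (hP : ∀ s, P s = SensorSelection.filteredCov Sig
      (SensorSelection.outputMatrix c s) (SensorSelection.noiseCov v s)) :
    U.PosDef ∧ L.PosDef ∧
    (∀ s, (P s).PosDef ∧
      P s = (Sig⁻¹ + (SensorSelection.outputMatrix c s).transpose *
        (SensorSelection.noiseCov v s)⁻¹ * SensorSelection.outputMatrix c s)⁻¹) ∧
    1 - δ ≤ μ.real {ω | L ≤ P (S ω) ∧ P (S ω) ≤ U} := by
  classical
  have hns' : (0 : ℝ) < ns := Nat.cast_pos.mpr hns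
  have hm' : (0 : ℝ) < m := Nat.cast_pos.mpr hm
  have hZ0 := sensorMatrix_nonneg c hv
  have hM : 0 ≤ meanMatrix c v p :=
    Finset.sum_nonneg fun j _ => smul_nonneg (hp.1 j) (hZ0 j)
  have hadd : ∀ {X : Matrix (Fin m) (Fin m) ℝ}, 0 ≤ X → (Sig⁻¹ + X).PosDef := fun hX =>
    hSig.inv.add_posSemidef hX.posSemidef
  have hlow : (Sig⁻¹ + ((1 - ε) * (ns : ℝ)) • meanMatrix c v p).PosDef :=
    hadd (smul_nonneg (mul_nonneg (by linarith [hε.2]) hns'.le) hM)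
  have hupp : (Sig⁻¹ + ((1 + ε) * (ns : ℝ)) • meanMatrix c v p).PosDef :=
    hadd (smul_nonneg (mul_nonneg (by linarith [hε.1]) hns'.le) hM)
  have hsel : ∀ s : Fin ns → Fin nc, (Sig⁻¹ + ∑ i, sensorMatrix c v (s i)).PosDef := fun s =>
    hadd (Finset.sum_nonneg fun i _ => hZ0 _)
  have hPs : ∀ s, P s = (Sig⁻¹ + ∑ i, sensorMatrix c v (s i))⁻¹ := fun s => by
    have hR : (noiseCov v s).PosDef := PosDef.diagonal fun i => hv (s i)
    rw [hP, filteredCov_eq_inv hSig _ hR,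
      outputMatrix_transpose_mul_noiseCov_inv_mul c hv]
  refine ⟨hU ▸ hlow.inv, hL ▸ hupp.inv, fun s => ⟨hPs s ▸ (hsel s).inv, ?_⟩, ?_⟩
  · rw [outputMatrix_transpose_mul_noiseCov_inv_mul c hv, hPs]
  -- If the bound failed for j, the event that the first sample equals j would be null, forcing p j
  -- = 0.
  have hZle : ∀ j, p j ≠ 0 → sensorMatrix c v j ≤ ρ • meanMatrix c v p := by
    intro j hj
    by_contra hcon
    refine hj ?_
    rw [← hS.law ⟨0, hns⟩ j, measureReal_eq_zero_iff]
    refine measure_mono_null (fun ω hω => ?_) (ae_iff.mp (hZ ⟨0, hns⟩))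
    rw [Set.mem_ofPred_eq] at hω ⊢
    rwa [hω]
  have htail := sum_prod_not_mem_Icc hp hZ0 rfl hρ hZle hε ns
  have hexp : 2 * (m : ℝ) * Real.exp (-(ns * ρ⁻¹ * ε ^ 2 / 4)) = δ := by
    have : ns * ρ⁻¹ * ε ^ 2 / 4 = Real.log (2 * (m : ℝ) / δ) := by
      rw [mul_assoc, inv_mul_eq_div, hc₀]
      field_simp
    have hδ0 := hδ.1
    rw [this, Real.exp_neg, Real.exp_log (by positivity)]
    field_simp
  rw [Fintype.card_fin, hexp, ← hS.measureReal_mem] at htail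
  have hmeas : MeasurableSet (S ⁻¹' {s | L ≤ P s ∧ P s ≤ U}) :=
    measurable_pi_lambda _ hS.measurable (Set.toFinite _).measurableSet
  have hcompl := probReal_compl_eq_one_sub (μ := μ) hmeas
  have hsub : (S ⁻¹' {s | L ≤ P s ∧ P s ≤ U})ᶜ ⊆ S ⁻¹' (Finset.univ.filter fun s =>
      ¬ (((1 - ε) * ns) • meanMatrix c v p ≤ ∑ i, sensorMatrix c v (s i) ∧
        ∑ i, sensorMatrix c v (s i) ≤ ((1 + ε) * ns) • meanMatrix c v p) :
      Finset (Fin ns → Fin nc)) := by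
    intro ω hω
    simp only [Set.mem_preimage, Finset.coe_filter, Finset.mem_univ, true_and, Set.mem_ofPred_eq]
    refine fun hgood => hω ?_
    rw [Set.mem_preimage, Set.mem_ofPred_eq, hPs, hU, hL]
    exact ⟨inv_le_inv_of_le (hsel _) (by gcongr; exact hgood.2),
      inv_le_inv_of_le hlow (by gcongr; exact hgood.1)⟩
  have hle := (measureReal_mono hsub).trans htail
  change _ ≤ μ.real (S ⁻¹' {s | L ≤ P s ∧ P s ≤ U})
  linarith
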